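/- Let $k$ be a field and let $\Lambda$ be a finite-dimensional $k$-algebra. Write $\Lambda\text{-Mod}$ for the category of all left $\Lambda$-modules, $\Lambda\text{-mod}$ for the full subcategory of finitely presented ones, and $D=D(\Lambda\text{-Mod})$ for the unbounded derived category. An object of $D$ is called perfect if it is isomorphic in $D$ to a bounded complex of finitely generated projective $\Lambda$-modules. By an object of $D(\Lambda\text{-mod})$ we mean here an object of $D$ that is isomorphic in $D$ to a (possibly unbounded) complex of finitely presented $\Lambda$-modules. Recall that $\Lambda$ is symmetric if it is isomorphic, as a $\Lambda$-bimodule, to its $k$-linear dual $\Lambda^{\vee}=\operatorname{Hom}_k(\Lambda,k)$, with bimodule structure $(a\varphi b)(y)=\varphi(bya)$. Then $\Lambda$ is symmetric if and only if, for every object $X$ of $D(\Lambda\text{-mod})$ and every perfect object $P$ of $D$, the $k$-vector spaces $\operatorname{Hom}_D(P,X)$ and $\operatorname{Hom}_D(X,P)$ are naturally dual; that is, if and only if there are perfect $k$-bilinear pairings $$\langle -,-\rangle_{P,X}\colon \operatorname{Hom}_D(P,X)\times\operatorname{Hom}_D(X,P)\to k$$ (each of the two spaces is identified by the pairing with the $k$-linear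 dual of the other), for all such $P$ and $X$, which are natural in both variables: $$\langle f\circ p,\,g\rangle_{P,X}=\langle f,\,p\circ g\rangle_{P',X}\qquad\text{for all } p\colon P\to P',\ f\colon P'\to X,\ g\colon X\to P,$$ $$\langle x\circ f,\,g\rangle_{P,X'}=\langle f,\,g\circ x\rangle_{P,X}\qquad\text{for all } x\colon X\to X',\ f\colon P\to X,\ g\colon X'\to P.$$ -/

import Mathlib

universe w u v

open CategoryTheory

namespace SymmetricDuality

/-- A `k`-algebra `Λ` is symmetric if `Λ` is isomorphic, as a `Λ`-`Λ`-bimodule, to its `k`-linear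
dual `Λ^∨`, whose bimodule structure is `(a • φ • b) y = φ (b * y * a)`. -/
def IsSymmetricAlgebra (k : Type u) (Λ : Type v) [Field k] [Ring Λ] [Algebra k Λ] : Prop :=
  ∃ e : Λ ≃ₗ[k] Module.Dual k Λ,
    (∀ a x y : Λ, e (a * x) y = e x (y * a)) ∧ (∀ x b y : Λ, e (x * b) y = e x (b * y))

section

variable (Λ : Type v) [Ring Λ] [HasDerivedCategory.{w} (ModuleCat.{v} Λ)]

/-- The perfect objects of `D(Λ-Mod)`: those isomorphic to a bounded complex of finitely generated
projective `Λ`-modules. -/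
def perfect : ObjectProperty (DerivedCategory (ModuleCat.{v} Λ)) := fun P =>
  ∃ K : CochainComplex (ModuleCat.{v} Λ) ℤ,
    (∃ a b : ℤ, K.IsStrictlyGE a ∧ K.IsStrictlyLE b) ∧
    (∀ i : ℤ, Module.Finite Λ (K.X i) ∧ Module.Projective Λ (K.X i)) ∧
    Nonempty (P ≅ DerivedCategory.Q.obj K)

/-- The objects of `D(Λ-Mod)` that come from `D(Λ-mod)`: those isomorphic to a (possibly
unbounded) complex of finitely presented `Λ`-modules. -/
def fromSmallMod : ObjectProperty (DerivedCategory (ModuleCat.{v} Λ)) := fun X =>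
  ∃ K : CochainComplex (ModuleCat.{v} Λ) ℤ,
    (∀ i : ℤ, Module.FinitePresentation Λ (K.X i)) ∧
    Nonempty (X ≅ DerivedCategory.Q.obj K)

end

/-- A natural duality between `Hom(P, X)` and `Hom(X, P)`, for `P` perfect and `X` from `D(Λ-mod)`:
a perfect `k`-bilinear pairing for every `P` and `X` (so that each of the two spaces is identified
with the `k`-linear dual of the other), natural in both variables. All `Hom`s are taken in
`D(Λ-Mod)`. -/
structure NaturalHomDuality (k : Type u) (Λ : Type v) [Field k] [Ring Λ] [Algebra k Λ]
    [HasDerivedCategory.{w} (ModuleCat.{v} Λ)] where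
  /-- the pairing of `Hom(P, X)` with `Hom(X, P)` -/
  pairing (P : (perfect Λ).FullSubcategory) (X : (fromSmallMod Λ).FullSubcategory) :
    (P.obj ⟶ X.obj) →ₗ[k] (X.obj ⟶ P.obj) →ₗ[k] k
  isPerfPair (P : (perfect Λ).FullSubcategory) (X : (fromSmallMod Λ).FullSubcategory) :
    (pairing P X).IsPerfPair
  natural_left {P P' : (perfect Λ).FullSubcategory} {X : (fromSmallMod Λ).FullSubcategory}
    (p : P.obj ⟶ P'.obj) (f : P'.obj ⟶ X.obj) (g : X.obj ⟶ P.obj) :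
    pairing P X (p ≫ f) g = pairing P' X f (g ≫ p)
  natural_right {P : (perfect Λ).FullSubcategory} {X X' : (fromSmallMod Λ).FullSubcategory}
    (x : X.obj ⟶ X'.obj) (f : P.obj ⟶ X.obj) (g : X'.obj ⟶ P.obj) :
    pairing P X' (f ≫ x) g = pairing P X f (x ≫ g)

end SymmetricDuality

/-!
A symmetric algebra is the same thing as an algebra with a *symmetrizing form*: a linear form
`t : Λ → k` with `t (a * b) = t (b * a)` and nondegenerate `(a, b) ↦ t (a * b)`.

Given such a form, the Hattori–Stallings trace composed with `t` gives a trace on the endomorphisms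
of every finitely generated projective module `P`, satisfying `trace (f ≫ g) = trace (g ≫ f)`, and
`(f, g) ↦ trace (f ≫ g)` is nondegenerate on `Hom(P, M) × Hom(M, P)` for every module `M`
(`eq_zero_of_trace_comp_left`, `eq_zero_of_trace_comp_right`). For a bounded complex `K` of such
modules, the alternating sum of traces vanishes on coboundaries (`supertrace_δ`), hence it induces a
trace on the endomorphisms of every perfect object of the derived category. The duality is
`⟨f, g⟩ = trace (f ≫ g)`, and its naturality is the cyclicity of the trace
(`PerfectModel.trace_comp_comm`).

For perfectness of this pairing, `K` is K-projective, and it is also K-injective because finitely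
generated projective modules over a symmetric algebra are injective
(`SymmetrizingForm.injective_of_projective`). So morphisms `K ⟶ X` and `X ⟶ K` in the derived
category are represented by chain maps. If `X` consists of finite-dimensional modules, then the
cochains `K ⟶ X` of degree `n` are in perfect duality with the cochains `X ⟶ K` of degree `-n`, and
the differentials are adjoint up to sign (`isPerfPair_cochainPairing`, `cochainPairing_δ`). As the
orthogonal of the kernel of a linear map is the range of its adjoint, a chain map orthogonal to all
chain maps in the other direction is null-homotopic (`exists_δ_eq_of_orthogonal_left`,
`exists_δ_eq_of_orthogonal_right`).

Conversely, given a natural duality, its value on the regular module in degree zero, whose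
endomorphisms are the right multiplications by elements of `Λ`, is a nondegenerate bilinear form on
`Λ`; the two naturality conditions say that the resulting map from `Λ` to its dual is a bimodule map
(`NaturalHomDuality.isSymmetricAlgebra`).
-/

namespace SymmetricDuality

/-! ### Symmetrizing forms -/

/-- A symmetrizing form on a `k`-algebra: a `k`-linear form `t` with `t (a * b) = t (b * a)` whose
associated bilinear form `(a, b) ↦ t (a * b)` is nondegenerate. -/
structure SymmetrizingForm (k : Type u) (Λ : Type v) [Field k] [Ring Λ] [Algebra k Λ] where
  /-- the linear form -/
  form : Λ →ₗ[k] k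
  form_mul_comm (a b : Λ) : form (a * b) = form (b * a)
  eq_zero_of_form_mul (a : Λ) (h : ∀ b, form (a * b) = 0) : a = 0

/-- The value at `1` of a bimodule isomorphism `Λ ≃ Λ^∨` is a symmetrizing form. -/
lemma IsSymmetricAlgebra.nonempty_symmetrizingForm {k : Type u} {Λ : Type v} [Field k] [Ring Λ]
    [Algebra k Λ] (h : IsSymmetricAlgebra k Λ) : Nonempty (SymmetrizingForm k Λ) := by
  obtain ⟨e, hl, hr⟩ := h
  have key (x y : Λ) : e 1 (x * y) = e x y := by simpa using (hr 1 x y).symm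
  refine ⟨⟨e 1, fun a b => ?_, fun a ha => ?_⟩⟩
  · rw [key]
    simpa using hl a 1 b
  · apply e.injective
    ext b
    rw [← key, ha, map_zero, LinearMap.zero_apply]

namespace SymmetrizingForm

variable {k : Type u} {Λ : Type v} [Field k] [Ring Λ] [Algebra k Λ]

lemma exists_form_mul_eq [FiniteDimensional k Λ] (t : SymmetrizingForm k Λ)
    (ξ : Module.Dual k Λ) : ∃ a, ∀ b, t.form (a * b) = ξ b := by
  let B : Λ →ₗ[k] Module.Dual k Λ := (LinearMap.mul k Λ).compr₂ t.form
  have hB : Function.Injective B := by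
    rw [← LinearMap.ker_eq_bot, LinearMap.ker_eq_bot']
    exact fun a ha => t.eq_zero_of_form_mul a fun b => LinearMap.congr_fun ha b
  obtain ⟨a, ha⟩ := (LinearMap.injective_iff_surjective_of_finrank_eq_finrank
    Subspace.dual_finrank_eq.symm).1 hB ξ
  exact ⟨a, fun b => LinearMap.congr_fun ha b⟩

lemma ext_form (t : SymmetrizingForm k Λ) {a b : Λ}
    (h : ∀ c, t.form (a * c) = t.form (b * c)) : a = b :=
  sub_eq_zero.1 <| t.eq_zero_of_form_mul _ fun c => by rw [sub_mul, map_sub, h, sub_self]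

/-- Composition with `t` identifies `Hom_Λ(M, Λ)` with the `k`-dual of `M`: every `k`-linear form
on `M` is of the form `t ∘ h`. -/
lemma exists_form_comp_eq [FiniteDimensional k Λ] (t : SymmetrizingForm k Λ) {M : Type*}
    [AddCommGroup M] [Module Λ M] [Module k M] [IsScalarTower k Λ M] (ξ : M →ₗ[k] k) :
    ∃ h : M →ₗ[Λ] Λ, ∀ m, t.form (h m) = ξ m := by
  choose h hh using fun m : M => t.exists_form_mul_eq
    (ξ ∘ₗ (LinearMap.toSpanSingleton Λ M m).restrictScalars k)
  simp only [LinearMap.comp_apply, LinearMap.restrictScalars_apply,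
    LinearMap.toSpanSingleton_apply] at hh
  refine ⟨{ toFun := h, map_add' := fun m n => ?_, map_smul' := fun a m => ?_ }, fun m => ?_⟩
  · exact t.ext_form fun c => by rw [add_mul, map_add, hh, hh, hh, smul_add, map_add]
  · refine t.ext_form fun c => ?_
    rw [hh, RingHom.id_apply, smul_eq_mul, mul_assoc, t.form_mul_comm, mul_assoc, hh, smul_smul]
  · simpa using hh m 1

end SymmetrizingForm

/-! ### The trace of an endomorphism of a finitely generated projective module -/

/-- A finite dual basis of a left module `P`: vectors `p i` and linear forms `φ i` such that
`x = ∑ i, φ i x • p i` for every `x`. No linear independence is required, and such a family exists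
if and only if `P` is finitely generated and projective. -/
structure FiniteDualBasis (Λ : Type*) (P : Type*) [Ring Λ] [AddCommGroup P] [Module Λ P] where
  /-- the number of vectors -/
  card : ℕ
  /-- the vectors -/
  vec : Fin card → P
  /-- the linear forms -/
  coord : Fin card → P →ₗ[Λ] Λ
  sum_coord_smul_vec (x : P) : ∑ i, coord i x • vec i = x

lemma FiniteDualBasis.nonempty (Λ : Type*) (P : Type*) [Ring Λ] [AddCommGroup P] [Module Λ P]
    [Module.Finite Λ P] [Module.Projective Λ P] : Nonempty (FiniteDualBasis Λ P) := by
  obtain ⟨n, f, g, -, -, hfg⟩ := Module.Finite.exists_comp_eq_id_of_projective Λ P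
  refine ⟨⟨n, fun i => f (Pi.single i 1), fun i => LinearMap.proj i ∘ₗ g, fun x => ?_⟩⟩
  have hx : f (g x) = x := LinearMap.congr_fun hfg x
  conv_rhs => rw [← hx, pi_eq_sum_univ' (g x), map_sum]
  refine Finset.sum_congr rfl fun i _ => ?_
  rw [← map_smul]
  congr 1

namespace FiniteDualBasis

variable {k : Type u} {Λ : Type v} [Field k] [Ring Λ] [Algebra k Λ] (t : SymmetrizingForm k Λ)
  {P Q M : Type*} [AddCommGroup P] [Module Λ P] [AddCommGroup Q] [Module Λ Q]
  [AddCommGroup M] [Module Λ M]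

/-- The trace of an endomorphism: the image under `t` of its Hattori–Stallings trace. -/
def trace (b : FiniteDualBasis Λ P) (f : P →ₗ[Λ] P) : k :=
  ∑ i, t.form (b.coord i (f (b.vec i)))

/-- The trace of a rank one endomorphism. -/
lemma trace_smulRight (b : FiniteDualBasis Λ P) (ψ : P →ₗ[Λ] Λ) (p : P) :
    b.trace t (ψ.smulRight p) = t.form (ψ p) := by
  conv_rhs => rw [← b.sum_coord_smul_vec p, map_sum, map_sum]
  refine Finset.sum_congr rfl fun i _ => ?_
  simp [t.form_mul_comm (ψ (b.vec i))]

lemma trace_add (b : FiniteDualBasis Λ P) (f g : P →ₗ[Λ] P) :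
    b.trace t (f + g) = b.trace t f + b.trace t g := by
  simp [trace, Finset.sum_add_distrib]

lemma trace_sum (b : FiniteDualBasis Λ P) {ι : Type*} (s : Finset ι) (f : ι → P →ₗ[Λ] P) :
    b.trace t (∑ i ∈ s, f i) = ∑ i ∈ s, b.trace t (f i) := by
  simp only [trace, LinearMap.sum_apply, map_sum]
  exact Finset.sum_comm

lemma trace_comp_comm (b : FiniteDualBasis Λ P) (b' : FiniteDualBasis Λ Q) (f : P →ₗ[Λ] Q)
    (g : Q →ₗ[Λ] P) : b.trace t (g ∘ₗ f) = b'.trace t (f ∘ₗ g) := by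
  -- `g ∘ f` is a sum of rank one maps, since `f x = ∑ j, b'.coord j (f x) • b'.vec j`
  have h₁ : g ∘ₗ f = ∑ j, (b'.coord j ∘ₗ f).smulRight (g (b'.vec j)) := by
    ext x
    conv_lhs => rw [LinearMap.comp_apply, ← b'.sum_coord_smul_vec (f x), map_sum]
    simp
  rw [h₁, trace_sum]
  simp only [trace_smulRight]
  rfl

/-- The trace form `(f, g) ↦ trace (g ∘ f)` on `Hom(P, M) × Hom(M, P)` is nondegenerate on the
left: if `f p ≠ 0`, test against the rank one map `m ↦ ψ m • p`, where `t ∘ ψ` is a linear form not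
vanishing at `f p`. -/
lemma eq_zero_of_trace_comp_left [FiniteDimensional k Λ] [Module k M] [IsScalarTower k Λ M]
    (b : FiniteDualBasis Λ P) (f : P →ₗ[Λ] M)
    (h : ∀ g : M →ₗ[Λ] P, b.trace t (g ∘ₗ f) = 0) : f = 0 := by
  ext p
  refine (Module.forall_dual_apply_eq_zero_iff k _).1 fun ξ => ?_
  obtain ⟨ψ, hψ⟩ := t.exists_form_comp_eq ξ
  rw [← hψ, ← LinearMap.comp_apply, ← b.trace_smulRight t]
  exact h (ψ.smulRight p)

/-- The trace form `(f, g) ↦ trace (g ∘ f)` on `Hom(P, M) × Hom(M, P)` is nondegenerate on the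
right: if `g m ≠ 0`, some coordinate `φ (g m)` is nonzero, and one tests against the rank one maps
`x ↦ (φ x * a) • m`. -/
lemma eq_zero_of_trace_comp_right (b : FiniteDualBasis Λ P) (g : M →ₗ[Λ] P)
    (h : ∀ f : P →ₗ[Λ] M, b.trace t (g ∘ₗ f) = 0) : g = 0 := by
  ext m
  rw [LinearMap.zero_apply, ← b.sum_coord_smul_vec (g m)]
  refine Finset.sum_eq_zero fun i _ => ?_
  suffices b.coord i (g m) = 0 by rw [this, zero_smul]
  refine t.eq_zero_of_form_mul _ fun a => ?_
  have key : g ∘ₗ ((b.coord i).smulRight a).smulRight m =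
      ((b.coord i).smulRight a).smulRight (g m) := by
    ext x
    simp
  have := h (((b.coord i).smulRight a).smulRight m)
  rwa [key, trace_smulRight] at this

end FiniteDualBasis

/-! ### Homomorphisms between modules over a finite-dimensional algebra -/

section ModuleCat

open scoped ModuleCat

variable {k : Type u} {Λ : Type v} [Field k] [Ring Λ] [Algebra k Λ] (t : SymmetrizingForm k Λ)

instance [FiniteDimensional k Λ] (P M : ModuleCat.{v} Λ) [Module.Finite Λ P] [Module.Finite Λ M] :
    FiniteDimensional k (P ⟶ M) := by
  have : Module.Finite k P := Module.Finite.trans Λ P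
  have : Module.Finite k M := Module.Finite.trans Λ M
  exact Module.Finite.of_injective
    (LinearMap.restrictScalarsₗ k Λ P M k ∘ₗ (ModuleCat.homLinearEquiv (S := k)).toLinearMap)
    ((LinearMap.restrictScalars_injective k).comp (ModuleCat.homLinearEquiv (S := k)).injective)

/-- Over a symmetric algebra, finitely generated projective modules are injective: extending
`Λ`-linear maps to `Λ` amounts to extending `k`-linear forms. -/
lemma SymmetrizingForm.injective_of_projective [FiniteDimensional k Λ]
    (t : SymmetrizingForm k Λ) (P : ModuleCat.{v} Λ)
    [Module.Finite Λ P] [Module.Projective Λ P] : Injective P where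
  factors {X Y} g f hf := by
    obtain ⟨b⟩ := FiniteDualBasis.nonempty Λ P
    rw [ModuleCat.mono_iff_injective] at hf
    obtain ⟨r, hr⟩ := (f.hom.restrictScalars k).exists_leftInverse_of_injective
      (LinearMap.ker_eq_bot.2 hf)
    choose h hh using fun i => t.exists_form_comp_eq
      (t.form ∘ₗ ((b.coord i ∘ₗ g.hom).restrictScalars k) ∘ₗ r)
    have key (i) (x : X) : h i (f.hom x) = b.coord i (g.hom x) := by
      refine t.ext_form fun c => ?_
      have hc : r (c • f.hom x) = c • x := by
        rw [← map_smul]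
        exact LinearMap.congr_fun hr (c • x)
      rw [t.form_mul_comm, t.form_mul_comm _ c, ← smul_eq_mul, ← map_smul, hh]
      simp [hc]
    refine ⟨ModuleCat.ofHom (∑ i, (h i).smulRight (b.vec i)), ?_⟩
    ext x
    simp [key, b.sum_coord_smul_vec]

variable (P Q : ModuleCat.{v} Λ) [Module.Finite Λ P] [Module.Projective Λ P]
  [Module.Finite Λ Q] [Module.Projective Λ Q]

/-- The trace of an endomorphism of a finitely generated projective module, as a `k`-linear
form. It does not depend on the finite dual basis chosen here, by `FiniteDualBasis.trace_comp_comm`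
with one of the two maps the identity. -/
noncomputable def trace : (P ⟶ P) →ₗ[k] k where
  toFun f := (FiniteDualBasis.nonempty Λ P).some.trace t f.hom
  map_add' f g := FiniteDualBasis.trace_add _ _ _ _
  map_smul' c f := by
    have (x : Λ) : t.form (algebraMap k Λ c * x) = c * t.form x := by
      rw [← Algebra.smul_def, map_smul, smul_eq_mul]
    simp only [FiniteDualBasis.trace, RingHom.id_apply, smul_eq_mul, Finset.mul_sum]
    refine Finset.sum_congr rfl fun i _ => ?_
    rw [← this, ← smul_eq_mul (a := algebraMap k Λ c), ← map_smul]
    rfl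

variable {P Q}

lemma trace_comp_comm (f : P ⟶ Q) (g : Q ⟶ P) : trace t P (f ≫ g) = trace t Q (g ≫ f) :=
  FiniteDualBasis.trace_comp_comm t _ _ f.hom g.hom

lemma eq_zero_of_trace_comp_left [FiniteDimensional k Λ] {M : ModuleCat.{v} Λ} (f : P ⟶ M)
    (h : ∀ g : M ⟶ P, trace t P (f ≫ g) = 0) : f = 0 := by
  ext1
  exact FiniteDualBasis.eq_zero_of_trace_comp_left t _ f.hom fun g => h (ModuleCat.ofHom g)

lemma eq_zero_of_trace_comp_right {M : ModuleCat.{v} Λ} (g : M ⟶ P)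
    (h : ∀ f : P ⟶ M, trace t P (f ≫ g) = 0) : g = 0 := by
  ext1
  exact FiniteDualBasis.eq_zero_of_trace_comp_right t _ g.hom fun f => h (ModuleCat.ofHom f)

end ModuleCat

/-! ### The supertrace and the pairing of cochains -/

section Cochain

open CochainComplex.HomComplex

/-- A bounded complex is only seen by finitely many degrees. -/
lemma support_finite_of_bounded {C A : Type*} [Category* C] [Limits.HasZeroMorphisms C] [Zero A]
    (K : CochainComplex C ℤ) (a b : ℤ) [K.IsStrictlyGE a] [K.IsStrictlyLE b] (c : ℤ → A)
    (hc : ∀ p, Limits.IsZero (K.X p) → c p = 0) : (Function.support c).Finite := by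
  refine (Set.finite_Icc a b).subset fun p hp => ⟨?_, ?_⟩ <;> by_contra hp' <;>
    refine hp (hc p ?_)
  · exact K.isZero_of_isStrictlyGE a p (by lia)
  · exact K.isZero_of_isStrictlyLE b p (by lia)

variable {k : Type u} {Λ : Type v} [Field k] [Ring Λ] [Algebra k Λ] (t : SymmetrizingForm k Λ)

section

variable {K K' : CochainComplex (ModuleCat.{v} Λ) ℤ}
  [∀ i, Module.Finite Λ (K.X i)] [∀ i, Module.Projective Λ (K.X i)]
  [∀ i, Module.Finite Λ (K'.X i)] [∀ i, Module.Projective Λ (K'.X i)]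

/-- The alternating sum of the traces of the components of a degree `0` cochain. Only finitely many
terms are nonzero when `K` is bounded; if infinitely many are, the `finsum` has the junk value
`0`. -/
noncomputable def supertrace (z : Cochain K K 0) : k :=
  ∑ᶠ p : ℤ, p.negOnePow • trace t (K.X p) (z.v p p (add_zero p))

lemma supertrace_comp_comm (f : Cochain K K' 0) (g : Cochain K' K 0) :
    supertrace t (f.comp g (add_zero 0)) = supertrace t (g.comp f (add_zero 0)) :=
  finsum_congr fun p => by
    rw [Cochain.comp_zero_cochain_v, Cochain.comp_zero_cochain_v, trace_comp_comm]

lemma support_negOnePow_smul_trace_finite (a b : ℤ) [K.IsStrictlyGE a] [K.IsStrictlyLE b]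
    (z : (p : ℤ) → (K.X p ⟶ K.X p)) :
    (Function.support fun p : ℤ => p.negOnePow • trace t (K.X p) (z p)).Finite :=
  support_finite_of_bounded K a b _ fun p hp => by simp [hp.eq_of_src (z p) 0]

variable (K) in
/-- The supertrace on degree `0` cochains of a bounded complex, as a `k`-linear form. -/
noncomputable def supertraceₗ (a b : ℤ) [K.IsStrictlyGE a] [K.IsStrictlyLE b] :
    Cochain K K 0 →ₗ[k] k where
  toFun := supertrace t
  map_add' f g := by
    simp only [supertrace, Cochain.add_v, map_add, smul_add]
    exact finsum_add_distrib
      (support_negOnePow_smul_trace_finite t a b _)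
      (support_negOnePow_smul_trace_finite t a b _)
  map_smul' c f := by
    simp only [supertrace, Cochain.smul_v, map_smul, smul_eq_mul, RingHom.id_apply]
    rw [← smul_eq_mul, smul_finsum' c (support_negOnePow_smul_trace_finite t a b _)]
    exact finsum_congr fun p => by rw [smul_eq_mul, mul_smul_comm]

variable (K) in
@[simp]
lemma supertraceₗ_apply (a b : ℤ) [K.IsStrictlyGE a] [K.IsStrictlyLE b] (z : Cochain K K 0) :
    supertraceₗ t K a b z = supertrace t z := rfl

/-- The supertrace vanishes on coboundaries: with `c p` the trace of `K.X p ⟶ K.X (p - 1) ⟶ K.X p`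
multiplied by `(-1) ^ p`, the `p`-th term is `c p - c (p + 1)`, so that the sum telescopes. -/
lemma supertrace_δ (a b : ℤ) [K.IsStrictlyGE a] [K.IsStrictlyLE b] (z : Cochain K K (-1)) :
    supertrace t (δ (-1) 0 z) = 0 := by
  let w (p : ℤ) : K.X p ⟶ K.X p := z.v p (p - 1) (by lia) ≫ K.d (p - 1) p
  let c (p : ℤ) : k := p.negOnePow • trace t (K.X p) (w p)
  have hw (q r : ℤ) (h : q + -1 = r) : z.v q r h ≫ K.d r q = w q := by
    obtain rfl : r = q - 1 := by lia
    rfl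
  have hc : (Function.support c).Finite :=
    support_negOnePow_smul_trace_finite t a b w
  have h (p : ℤ) : p.negOnePow • trace t (K.X p) ((δ (-1) 0 z).v p p (add_zero p)) =
      c p - c (p + 1) := by
    rw [δ_v (-1) 0 (neg_add_cancel 1) z p p (add_zero p) (p - 1) (p + 1) rfl rfl]
    simp only [Int.negOnePow_zero, one_smul, map_add, smul_add, c, Int.negOnePow_succ,
      Units.neg_smul, sub_neg_eq_add]
    rw [trace_comp_comm t (K.d p (p + 1)), hw (p + 1) p (add_neg_cancel_right p 1)]
  rw [supertrace, finsum_congr h, finsum_sub_distrib hc, sub_eq_zero]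
  · exact (finsum_comp_equiv (Equiv.addRight (1 : ℤ)) (f := c)).symm
  · exact hc.preimage (add_left_injective (1 : ℤ)).injOn

end

section

lemma finiteDimensional_cochain [FiniteDimensional k Λ] {K X : CochainComplex (ModuleCat.{v} Λ) ℤ}
    (a b : ℤ) [K.IsStrictlyGE a] [K.IsStrictlyLE b] [∀ i, Module.Finite Λ (K.X i)]
    [∀ i, Module.Finite Λ (X.X i)] (n : ℤ) : FiniteDimensional k (Cochain K X n) := by
  let F : Cochain K X n →ₗ[k] ((p : Set.Icc a b) → (K.X p ⟶ X.X (p + n))) :=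
    { toFun z p := z.v p (p + n) rfl
      map_add' _ _ := rfl
      map_smul' _ _ := rfl }
  refine Module.Finite.of_injective F ?_
  rw [← LinearMap.ker_eq_bot, LinearMap.ker_eq_bot']
  intro z hz
  ext1 p q hpq
  by_cases hpa : a ≤ p
  · by_cases hpb : p ≤ b
    · subst hpq
      exact congr_fun hz ⟨p, hpa, hpb⟩
    · exact (K.isZero_of_isStrictlyLE b p (by lia)).eq_of_src _ _
  · exact (K.isZero_of_isStrictlyGE a p (by lia)).eq_of_src _ _

variable {K X : CochainComplex (ModuleCat.{v} Λ) ℤ}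
  [∀ i, Module.Finite Λ (K.X i)] [∀ i, Module.Projective Λ (K.X i)]

variable (K X) in
/-- The pairing of cochains `K ⟶ X` of degree `n` with cochains `X ⟶ K` of degree `-n` given by the
supertrace of the composition. -/
noncomputable def cochainPairing (a b : ℤ) [K.IsStrictlyGE a] [K.IsStrictlyLE b]
    {n m : ℤ} (h : n + m = 0) :
    Cochain K X n →ₗ[k] Cochain X K m →ₗ[k] k :=
  LinearMap.mk₂ k (fun f g => supertraceₗ t K a b (f.comp g h))
    (by simp [-supertraceₗ_apply]) (by simp [-supertraceₗ_apply])
    (by simp [-supertraceₗ_apply]) (by simp [-supertraceₗ_apply])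

lemma cochainPairing_apply (a b : ℤ) [K.IsStrictlyGE a] [K.IsStrictlyLE b]
    {n m : ℤ} (h : n + m = 0) (f : Cochain K X n) (g : Cochain X K m) :
    cochainPairing t K X a b h f g = supertrace t (f.comp g h) := rfl

/-- The differentials are adjoint for the pairing of cochains, up to a sign. -/
lemma cochainPairing_δ (a b : ℤ) [K.IsStrictlyGE a] [K.IsStrictlyLE b]
    {n n' m m' : ℤ} (hn : n + 1 = n') (hm : m + 1 = m') (h : n + m' = 0)
    (h' : n' + m = 0) (f : Cochain K X n) (g : Cochain X K m) :
    cochainPairing t K X a b h f (δ m m' g) =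
      -(m.negOnePow • cochainPairing t K X a b h' (δ n n' f) g) := by
  have := δ_comp f g (show n + m = -1 by lia) n' m' 0 (by lia) hn hm
  have h₀ := supertrace_δ t a b (f.comp g (show n + m = -1 by lia))
  rw [this, ← supertraceₗ_apply t K a b, map_add, add_eq_zero_iff_eq_neg, Units.smul_def,
    map_zsmul] at h₀
  exact h₀

lemma supertrace_single_comp {n m : ℤ} (h : n + m = 0) {p q : ℤ} (hpq : p + n = q)
    (f : K.X p ⟶ X.X q) (g : Cochain X K m) :
    supertrace t ((Cochain.single f n).comp g h) =
      p.negOnePow • trace t (K.X p) (f ≫ g.v q p (by lia)) := by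
  rw [supertrace, finsum_eq_single _ p fun p' hp' => ?_]
  · rw [Cochain.comp_v _ _ h p q p hpq (by lia), Cochain.single_v]
  · rw [Cochain.comp_v _ _ h p' (p' + n) p' rfl (by lia),
      Cochain.single_v_eq_zero _ _ _ _ _ hp', Limits.zero_comp, map_zero, smul_zero]

lemma supertrace_comp_single {n m : ℤ} (h : n + m = 0) {p q : ℤ} (hpq : p + n = q)
    (f : Cochain K X n) (g : X.X q ⟶ K.X p) :
    supertrace t (f.comp (Cochain.single g m) h) =
      p.negOnePow • trace t (K.X p) (f.v p q hpq ≫ g) := by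
  rw [supertrace, finsum_eq_single _ p fun p' hp' => ?_]
  · rw [Cochain.comp_v _ _ h p q p hpq (by lia), Cochain.single_v]
  · rw [Cochain.comp_v _ _ h p' (p' + n) p' rfl (by lia),
      Cochain.single_v_eq_zero' _ _ _ _ _ hp', Limits.comp_zero, map_zero, smul_zero]

variable [∀ i, Module.Finite Λ (X.X i)] [FiniteDimensional k Λ]

/-- In each degree, the pairing of cochains is a finite sum of trace forms, hence perfect; cochains
concentrated in a single degree detect each component. -/
lemma isPerfPair_cochainPairing (a b : ℤ) [K.IsStrictlyGE a] [K.IsStrictlyLE b]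
    {n m : ℤ} (h : n + m = 0) :
    (cochainPairing t K X a b h).IsPerfPair := by
  have := finiteDimensional_cochain (k := k) (K := K) (X := X) a b n
  refine LinearMap.IsPerfPair.of_injective ?_ ?_
  · rw [← LinearMap.ker_eq_bot, LinearMap.ker_eq_bot']
    intro f hf
    ext1 p q hpq
    refine eq_zero_of_trace_comp_left t _ fun g => ?_
    have := LinearMap.congr_fun hf (Cochain.single g m)
    rwa [cochainPairing_apply, supertrace_comp_single t h hpq, LinearMap.zero_apply,
      smul_eq_zero_iff_eq] at this
  · rw [← LinearMap.ker_eq_bot, LinearMap.ker_eq_bot']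
    intro g hg
    ext1 q p hqp
    refine eq_zero_of_trace_comp_right t _ fun f => ?_
    have := LinearMap.congr_fun hg (Cochain.single f n)
    rwa [LinearMap.flip_apply, cochainPairing_apply,
      supertrace_single_comp t h (show p + n = q by lia), LinearMap.zero_apply,
      smul_eq_zero_iff_eq] at this

/-- A degree `0` cochain `K ⟶ X` orthogonal to all cocycles `X ⟶ K` is a coboundary, as the
orthogonal of the kernel of a linear map is the range of its adjoint. -/
lemma exists_δ_eq_of_orthogonal_left (a b : ℤ) [K.IsStrictlyGE a]
    [K.IsStrictlyLE b] (f : Cochain K X 0)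
    (h : ∀ g : Cochain X K 0, δ 0 1 g = 0 → supertrace t (f.comp g (add_zero 0)) = 0) :
    ∃ z : Cochain K X (-1), δ (-1) 0 z = f := by
  have := isPerfPair_cochainPairing t (K := K) (X := X) a b (neg_add_cancel 1)
  have h₀ := isPerfPair_cochainPairing t (K := K) (X := X) a b (add_zero 0)
  have hf : cochainPairing t K X a b (add_zero 0) f ∈
      (LinearMap.ker (δ_hom k X K 0 1)).dualAnnihilator := by
    rw [Submodule.mem_dualAnnihilator]
    exact fun g hg => h g hg
  rw [← LinearMap.range_dualMap_eq_dualAnnihilator_ker] at hf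
  -- `⟨f, -⟩` factors through the differential as `ξ ∘ δ`, and `ξ` is represented by a cochain
  obtain ⟨ξ, hξ⟩ := hf
  obtain ⟨z, rfl⟩ := (LinearMap.IsPerfPair.bijective_left
    (cochainPairing t K X a b (neg_add_cancel 1))).surjective ξ
  refine ⟨-z, (LinearMap.IsPerfPair.bijective_left _).injective
    (LinearMap.ext fun g => (?_ : _ = cochainPairing t K X a b (add_zero 0) f g))⟩
  rw [← hξ]
  refine Eq.trans ?_
    (cochainPairing_δ t a b (neg_add_cancel 1) (zero_add 1) _ (add_zero 0) z g).symm
  simp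

/-- A degree `0` cochain `X ⟶ K` orthogonal to all cocycles `K ⟶ X` is a coboundary. -/
lemma exists_δ_eq_of_orthogonal_right (a b : ℤ) [K.IsStrictlyGE a]
    [K.IsStrictlyLE b] (g : Cochain X K 0)
    (h : ∀ f : Cochain K X 0, δ 0 1 f = 0 → supertrace t (f.comp g (add_zero 0)) = 0) :
    ∃ z : Cochain X K (-1), δ (-1) 0 z = g := by
  have := isPerfPair_cochainPairing t (K := K) (X := X) a b (add_neg_cancel 1)
  have h₀ := isPerfPair_cochainPairing t (K := K) (X := X) a b (add_zero 0)
  have hg : (cochainPairing t K X a b (add_zero 0)).flip g ∈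
      (LinearMap.ker (δ_hom k K X 0 1)).dualAnnihilator := by
    rw [Submodule.mem_dualAnnihilator]
    exact fun f hf => h f hf
  rw [← LinearMap.range_dualMap_eq_dualAnnihilator_ker] at hg
  -- `⟨-, g⟩` factors through the differential as `ξ ∘ δ`, and `ξ` is represented by a cochain
  obtain ⟨ξ, hξ⟩ := hg
  obtain ⟨z, rfl⟩ := (LinearMap.IsPerfPair.bijective_right
    (cochainPairing t K X a b (add_neg_cancel 1))).surjective ξ
  refine ⟨z, (LinearMap.IsPerfPair.bijective_right _).injective
    (LinearMap.ext fun f => (?_ : _ = (cochainPairing t K X a b (add_zero 0)).flip g f))⟩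
  rw [← hξ]
  refine (cochainPairing_δ t a b (zero_add 1) (neg_add_cancel 1) (add_zero 0)
    (add_neg_cancel 1) f z).trans ?_
  simp

end

end Cochain

/-! ### Morphisms in the derived category and chain maps -/

section Lifting

open CochainComplex CochainComplex.HomComplex DerivedCategory

variable {C : Type*} [Category* C] [Abelian C] [HasDerivedCategory.{w} C]

lemma Q_map_surjective_of_isKProjective (K X : CochainComplex C ℤ) [K.IsKProjective] :
    Function.Surjective (Q.map : (K ⟶ X) → (Q.obj K ⟶ Q.obj X)) := by
  intro φ
  obtain ⟨ψ, hψ⟩ := (IsKProjective.Qh_map_bijective K ((HomotopyCategory.quotient _ _).obj X)).2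
    ((quotientCompQhIso C).hom.app K ≫ φ ≫ (quotientCompQhIso C).inv.app X)
  obtain ⟨f, rfl⟩ := (HomotopyCategory.quotient _ _).map_surjective ψ
  refine ⟨f, ?_⟩
  rw [← cancel_epi ((quotientCompQhIso C).hom.app K), ← quotientCompQhIso_hom_naturality, hψ]
  simp

lemma Q_map_surjective_of_isKInjective (X K : CochainComplex C ℤ) [K.IsKInjective] :
    Function.Surjective (Q.map : (X ⟶ K) → (Q.obj X ⟶ Q.obj K)) := by
  intro φ
  obtain ⟨ψ, hψ⟩ := (IsKInjective.Qh_map_bijective ((HomotopyCategory.quotient _ _).obj X) K).2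
    ((quotientCompQhIso C).hom.app X ≫ φ ≫ (quotientCompQhIso C).inv.app K)
  obtain ⟨f, rfl⟩ := (HomotopyCategory.quotient _ _).map_surjective ψ
  refine ⟨f, ?_⟩
  rw [← cancel_epi ((quotientCompQhIso C).hom.app X), ← quotientCompQhIso_hom_naturality, hψ]
  simp

lemma exists_δ_eq_of_Q_map_eq_zero {K X : CochainComplex C ℤ} [K.IsKProjective] {f : K ⟶ X}
    (hf : Q.map f = 0) : ∃ z : Cochain K X (-1), δ (-1) 0 z = Cochain.ofHom f := by
  have h : (HomotopyCategory.quotient _ _).map f = (HomotopyCategory.quotient _ _).map 0 := by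
    apply (IsKProjective.Qh_map_bijective K ((HomotopyCategory.quotient _ _).obj X)).1
    rw [← cancel_mono ((quotientCompQhIso C).hom.app X)]
    simp [quotientCompQhIso_hom_naturality, hf, -NatTrans.naturality]
  exact ⟨Cochain.ofHomotopy (HomotopyCategory.homotopyOfEq _ _ h), by simp⟩

lemma Q_map_eq_zero_of_δ_eq {K X : CochainComplex C ℤ} {f : K ⟶ X} {z : Cochain K X (-1)}
    (hz : δ (-1) 0 z = Cochain.ofHom f) : Q.map f = 0 := by
  rw [Q_map_eq_of_homotopy (C := C) ((Cochain.equivHomotopy f 0).symm ⟨z, by simp [hz]⟩),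
    Functor.map_zero]

end Lifting

/-! ### The trace form of a perfect object -/

section Perfect

open CochainComplex CochainComplex.HomComplex DerivedCategory

variable {k : Type u} {Λ : Type v} [Field k] [Ring Λ] [Algebra k Λ]
  [HasDerivedCategory.{w} (ModuleCat.{v} Λ)]

/-- A bounded complex of finitely generated projective modules representing an object `P` of the
derived category, together with bounds and the isomorphism. -/
structure PerfectModel (P : DerivedCategory (ModuleCat.{v} Λ)) where
  /-- the complex -/
  complex : CochainComplex (ModuleCat.{v} Λ) ℤ
  /-- a lower bound for the degrees of the nonzero terms -/
  lower : ℤ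
  /-- an upper bound for the degrees of the nonzero terms -/
  upper : ℤ
  isStrictlyGE : complex.IsStrictlyGE lower
  isStrictlyLE : complex.IsStrictlyLE upper
  finite (i : ℤ) : Module.Finite Λ (complex.X i)
  projective (i : ℤ) : Module.Projective Λ (complex.X i)
  /-- the isomorphism with the given object -/
  iso : P ≅ Q.obj complex

attribute [instance] PerfectModel.isStrictlyGE PerfectModel.isStrictlyLE PerfectModel.finite
  PerfectModel.projective

lemma perfect.nonempty_perfectModel {P : DerivedCategory (ModuleCat.{v} Λ)} (hP : perfect Λ P) :
    Nonempty (PerfectModel P) := by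
  obtain ⟨K, ⟨a, b, ha, hb⟩, hK, ⟨e⟩⟩ := hP
  exact ⟨⟨K, a, b, ha, hb, fun i => (hK i).1, fun i => (hK i).2, e⟩⟩

namespace PerfectModel

variable {P P' X : DerivedCategory (ModuleCat.{v} Λ)} (M : PerfectModel P) (M' : PerfectModel P')

instance : M.complex.IsKProjective :=
  have (i : ℤ) : Projective (M.complex.X i) :=
    ModuleCat.projective_of_categoryTheory_projective _
  isKProjective_of_projective M.complex M.upper

/-- The complex is bounded below, and its terms are injective because `Λ` is symmetric. -/
lemma isKInjective [FiniteDimensional k Λ] (t : SymmetrizingForm k Λ) : M.complex.IsKInjective :=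
  have (i : ℤ) : Injective (M.complex.X i) := t.injective_of_projective _
  isKInjective_of_injective M.complex M.lower

variable (t : SymmetrizingForm k Λ)

/-- A chain map representing an endomorphism of a perfect object. -/
noncomputable def lift (φ : P ⟶ P) : M.complex ⟶ M.complex :=
  (Q_map_surjective_of_isKProjective M.complex M.complex (M.iso.inv ≫ φ ≫ M.iso.hom)).choose

lemma Q_map_lift (φ : P ⟶ P) : Q.map (M.lift φ) = M.iso.inv ≫ φ ≫ M.iso.hom :=
  (Q_map_surjective_of_isKProjective M.complex M.complex _).choose_spec

/-- The supertrace of a chain map depends only on its image in the derived category. -/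
lemma supertrace_eq_of_Q_map_eq {f g : M.complex ⟶ M.complex} (h : Q.map f = Q.map g) :
    supertrace t (Cochain.ofHom f) = supertrace t (Cochain.ofHom g) := by
  obtain ⟨z, hz⟩ := exists_δ_eq_of_Q_map_eq_zero
    (show Q.map (f - g) = 0 by rw [Functor.map_sub, h, sub_self])
  have := supertrace_δ t M.lower M.upper z
  rwa [hz, Cochain.ofHom_sub, ← supertraceₗ_apply t M.complex M.lower M.upper, map_sub,
    sub_eq_zero] at this

lemma supertrace_lift_eq {φ : P ⟶ P} {f : M.complex ⟶ M.complex}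
    (h : Q.map f = M.iso.inv ≫ φ ≫ M.iso.hom) :
    supertrace t (Cochain.ofHom (M.lift φ)) = supertrace t (Cochain.ofHom f) :=
  M.supertrace_eq_of_Q_map_eq t (by rw [h, Q_map_lift])

/-- The trace of an endomorphism of a perfect object: the supertrace of any chain map representing
it. -/
noncomputable def trace : (P ⟶ P) →ₗ[k] k where
  toFun φ := supertrace t (Cochain.ofHom (M.lift φ))
  map_add' φ ψ := by
    rw [M.supertrace_lift_eq t (f := M.lift φ + M.lift ψ) (by simp [Q_map_lift]),
      Cochain.ofHom_add]
    exact map_add (supertraceₗ t M.complex M.lower M.upper) _ _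
  map_smul' c φ := by
    rw [M.supertrace_lift_eq t (f := c • M.lift φ) (by simp [Q_map_lift, Functor.map_smul])]
    exact map_smul (supertraceₗ t M.complex M.lower M.upper) c (Cochain.ofHom (M.lift φ))

lemma trace_eq {φ : P ⟶ P} {f : M.complex ⟶ M.complex}
    (h : Q.map f = M.iso.inv ≫ φ ≫ M.iso.hom) :
    M.trace t φ = supertrace t (Cochain.ofHom f) :=
  M.supertrace_lift_eq t h

lemma trace_comp_comm (φ : P ⟶ P') (ψ : P' ⟶ P) : M.trace t (φ ≫ ψ) = M'.trace t (ψ ≫ φ) := by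
  obtain ⟨f, hf⟩ := Q_map_surjective_of_isKProjective M.complex M'.complex
    (M.iso.inv ≫ φ ≫ M'.iso.hom)
  obtain ⟨g, hg⟩ := Q_map_surjective_of_isKProjective M'.complex M.complex
    (M'.iso.inv ≫ ψ ≫ M.iso.hom)
  rw [M.trace_eq t (f := f ≫ g) (by simp [hf, hg]), M'.trace_eq t (f := g ≫ f) (by simp [hf, hg]),
    Cochain.ofHom_comp, Cochain.ofHom_comp, supertrace_comp_comm]

variable (X) in
/-- The pairing of `Hom(P, X)` with `Hom(X, P)` given by the trace of the composition. -/
noncomputable def pairing : (P ⟶ X) →ₗ[k] (X ⟶ P) →ₗ[k] k :=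
  LinearMap.mk₂ k (fun φ ψ => M.trace t (φ ≫ ψ)) (by simp) (by simp) (by simp) (by simp)

@[simp]
lemma pairing_apply (φ : P ⟶ X) (ψ : X ⟶ P) : M.pairing X t φ ψ = M.trace t (φ ≫ ψ) := rfl

lemma trace_eq_supertrace_comp {K : CochainComplex (ModuleCat.{v} Λ) ℤ} (e : X ≅ Q.obj K)
    {φ : P ⟶ X} {ψ : X ⟶ P} {f : M.complex ⟶ K} {g : K ⟶ M.complex}
    (hf : Q.map f = M.iso.inv ≫ φ ≫ e.hom) (hg : Q.map g = e.inv ≫ ψ ≫ M.iso.hom) :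
    M.trace t (φ ≫ ψ) = supertrace t ((Cochain.ofHom f).comp (Cochain.ofHom g) (add_zero 0)) := by
  rw [M.trace_eq t (f := f ≫ g) (by simp [hf, hg]), Cochain.ofHom_comp]

section

variable [FiniteDimensional k Λ] {K : CochainComplex (ModuleCat.{v} Λ) ℤ}
  [∀ i, Module.Finite Λ (K.X i)]

lemma finiteDimensional_hom (M : PerfectModel P) (e : X ≅ Q.obj K) :
    FiniteDimensional k (P ⟶ X) := by
  have := finiteDimensional_cochain (k := k) (K := M.complex) (X := K) M.lower M.upper 0
  let F : (M.complex ⟶ K) →ₗ[k] Cochain M.complex K 0 :=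
    { toFun := Cochain.ofHom
      map_add' := Cochain.ofHom_add
      map_smul' c f := by ext; simp }
  have : FiniteDimensional k (M.complex ⟶ K) :=
    Module.Finite.of_injective F fun f g h => Cochain.ofHom_injective h
  have : FiniteDimensional k (Q.obj M.complex ⟶ Q.obj K) :=
    Module.Finite.of_surjective (Q.mapLinearMap k)
      (Q_map_surjective_of_isKProjective M.complex K)
  exact Module.Finite.equiv (Linear.homCongr k M.iso e).symm

lemma eq_zero_of_trace_comp_left (e : X ≅ Q.obj K) (φ : P ⟶ X)
    (h : ∀ ψ : X ⟶ P, M.trace t (φ ≫ ψ) = 0) :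
    φ = 0 := by
  obtain ⟨f, hf⟩ := Q_map_surjective_of_isKProjective M.complex K (M.iso.inv ≫ φ ≫ e.hom)
  obtain ⟨z, hz⟩ := exists_δ_eq_of_orthogonal_left t M.lower M.upper (Cochain.ofHom f)
    fun g hg => by
      let g' : K ⟶ M.complex := Cocycle.homOf (Cocycle.mk g 1 (zero_add 1) hg)
      have hg' : Cochain.ofHom g' = g := Cocycle.cochain_ofHom_homOf_eq_coe _
      rw [← hg', ← M.trace_eq_supertrace_comp t e hf
        (ψ := e.hom ≫ Q.map g' ≫ M.iso.inv) (by simp)]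
      exact h _
  rw [Q_map_eq_zero_of_δ_eq hz] at hf
  simpa using hf.symm

lemma eq_zero_of_trace_comp_right (e : X ≅ Q.obj K) (ψ : X ⟶ P)
    (h : ∀ φ : P ⟶ X, M.trace t (φ ≫ ψ) = 0) :
    ψ = 0 := by
  have := M.isKInjective t
  obtain ⟨g, hg⟩ := Q_map_surjective_of_isKInjective K M.complex (e.inv ≫ ψ ≫ M.iso.hom)
  obtain ⟨z, hz⟩ := exists_δ_eq_of_orthogonal_right t M.lower M.upper (Cochain.ofHom g)
    fun f hf => by
      let f' : M.complex ⟶ K := Cocycle.homOf (Cocycle.mk f 1 (zero_add 1) hf)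
      have hf' : Cochain.ofHom f' = f := Cocycle.cochain_ofHom_homOf_eq_coe _
      rw [← hf', ← M.trace_eq_supertrace_comp t e
        (φ := M.iso.hom ≫ Q.map f' ≫ e.inv) (by simp) hg]
      exact h _
  rw [Q_map_eq_zero_of_δ_eq hz] at hg
  simpa using hg.symm

end

lemma isPerfPair_pairing [FiniteDimensional k Λ] (hX : fromSmallMod Λ X) :
    (M.pairing X t).IsPerfPair := by
  obtain ⟨K, hK, ⟨e⟩⟩ := hX
  have (i : ℤ) : Module.Finite Λ (K.X i) := have := hK i; inferInstance
  have := M.finiteDimensional_hom (k := k) e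
  refine LinearMap.IsPerfPair.of_injective ?_ ?_
  · rw [← LinearMap.ker_eq_bot, LinearMap.ker_eq_bot']
    exact fun φ hφ => M.eq_zero_of_trace_comp_left t e φ fun ψ => LinearMap.congr_fun hφ ψ
  · rw [← LinearMap.ker_eq_bot, LinearMap.ker_eq_bot']
    exact fun ψ hψ => M.eq_zero_of_trace_comp_right t e ψ fun φ => LinearMap.congr_fun hψ φ

end PerfectModel

/-- The trace pairings attached to a symmetrizing form are a natural duality. -/
noncomputable def SymmetrizingForm.naturalHomDuality [FiniteDimensional k Λ]
    (t : SymmetrizingForm k Λ) : NaturalHomDuality.{w} k Λ where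
  pairing P X := P.property.nonempty_perfectModel.some.pairing X.obj t
  isPerfPair P X := P.property.nonempty_perfectModel.some.isPerfPair_pairing t X.property
  natural_left {P P' X} p f g := by
    simp only [PerfectModel.pairing_apply, Category.assoc]
    rw [PerfectModel.trace_comp_comm _ P'.property.nonempty_perfectModel.some, Category.assoc]
  natural_right x f g := by
    simp only [PerfectModel.pairing_apply, Category.assoc]

/-! ### Symmetry of an algebra with a natural duality -/

lemma singleFunctor_X_eq_or_isZero {C : Type*} [Category* C] [Abelian C] (A : C) (i : ℤ) :
    Nonempty (((CochainComplex.singleFunctor C 0).obj A).X i ≅ A) ∨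
      Limits.IsZero (((CochainComplex.singleFunctor C 0).obj A).X i) := by
  by_cases h : i = 0
  · subst h
    exact Or.inl ⟨HomologicalComplex.singleObjXSelf _ _ _⟩
  · exact Or.inr (HomologicalComplex.isZero_single_obj_X _ _ _ _ h)

lemma finitePresentation_and_projective_of_isZero {Λ : Type v} [Ring Λ] {M : ModuleCat.{v} Λ}
    (h : Limits.IsZero M) : Module.FinitePresentation Λ M ∧ Module.Projective Λ M := by
  have := ModuleCat.subsingleton_of_isZero h
  exact ⟨inferInstance, Module.Projective.of_free⟩

/-- The terms of the complex with the regular module in degree zero are finitely presented and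
projective. -/
lemma singleFunctor_self_X (Λ : Type v) [Ring Λ] (i : ℤ) :
    Module.FinitePresentation Λ
        (((CochainComplex.singleFunctor _ 0).obj (ModuleCat.of Λ Λ)).X i) ∧
      Module.Projective Λ
        (((CochainComplex.singleFunctor _ 0).obj (ModuleCat.of Λ Λ)).X i) := by
  obtain ⟨⟨e⟩⟩ | h := singleFunctor_X_eq_or_isZero (ModuleCat.of Λ Λ) i
  · exact ⟨Module.FinitePresentation.of_equiv e.toLinearEquiv.symm,
      Module.Projective.of_equiv e.toLinearEquiv.symm⟩
  · exact finitePresentation_and_projective_of_isZero h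

lemma perfect_singleFunctor_self (Λ : Type v) [Ring Λ]
    [HasDerivedCategory.{w} (ModuleCat.{v} Λ)] :
    perfect Λ ((DerivedCategory.singleFunctor (ModuleCat.{v} Λ) 0).obj (ModuleCat.of Λ Λ)) :=
  ⟨(CochainComplex.singleFunctor _ 0).obj (ModuleCat.of Λ Λ), ⟨0, 0, inferInstance, inferInstance⟩,
    fun i => ⟨have := (singleFunctor_self_X Λ i).1; inferInstance, (singleFunctor_self_X Λ i).2⟩,
    ⟨(singleFunctorIsoCompQ _ 0).app _⟩⟩

lemma fromSmallMod_singleFunctor_self (Λ : Type v) [Ring Λ]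
    [HasDerivedCategory.{w} (ModuleCat.{v} Λ)] :
    fromSmallMod Λ ((DerivedCategory.singleFunctor (ModuleCat.{v} Λ) 0).obj (ModuleCat.of Λ Λ)) :=
  ⟨(CochainComplex.singleFunctor _ 0).obj (ModuleCat.of Λ Λ),
    fun i => (singleFunctor_self_X Λ i).1, ⟨(singleFunctorIsoCompQ _ 0).app _⟩⟩

/-- Right multiplication identifies `Λ` with the endomorphisms of the left regular module placed in
degree zero of the derived category. -/
noncomputable def regularEndEquiv (k : Type u) (Λ : Type v) [Field k] [Ring Λ] [Algebra k Λ]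
    [HasDerivedCategory.{w} (ModuleCat.{v} Λ)] :
    Λ ≃ₗ[k] ((DerivedCategory.singleFunctor (ModuleCat.{v} Λ) 0).obj (ModuleCat.of Λ Λ) ⟶
      (DerivedCategory.singleFunctor (ModuleCat.{v} Λ) 0).obj (ModuleCat.of Λ Λ)) :=
  let S := DerivedCategory.singleFunctor (ModuleCat.{v} Λ) 0
  let R (a : Λ) : ModuleCat.of Λ Λ ⟶ ModuleCat.of Λ Λ :=
    ModuleCat.ofHom (LinearMap.toSpanSingleton Λ Λ a)
  let F : Λ →ₗ[k] (S.obj (ModuleCat.of Λ Λ) ⟶ S.obj (ModuleCat.of Λ Λ)) :=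
    { toFun a := S.map (R a)
      map_add' a b := by
        rw [← S.map_add]
        congr 1
        ext
        simp [R]
      map_smul' c a := by
        rw [RingHom.id_apply, ← S.map_smul]
        congr 1
        ext
        -- on morphisms of `ModuleCat Λ`, the field `k` acts through `algebraMap k Λ`
        change (1 : Λ) * (c • a) = algebraMap k Λ c * (1 * a)
        rw [one_mul, one_mul, Algebra.smul_def] }
  LinearEquiv.ofBijective F <| by
    refine ⟨fun a b h => ?_, fun φ => ?_⟩
    · simpa [R] using congr(($(S.map_injective h)).hom 1)
    · obtain ⟨f, rfl⟩ := S.map_surjective φ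
      refine ⟨f.hom 1, congrArg S.map ?_⟩
      ext
      simp [R]

lemma regularEndEquiv_mul (k : Type u) (Λ : Type v) [Field k] [Ring Λ] [Algebra k Λ]
    [HasDerivedCategory.{w} (ModuleCat.{v} Λ)] (a b : Λ) :
    regularEndEquiv k Λ (a * b) = regularEndEquiv k Λ a ≫ regularEndEquiv k Λ b := by
  let S := DerivedCategory.singleFunctor (ModuleCat.{v} Λ) 0
  change S.map _ = S.map _ ≫ S.map _
  rw [← S.map_comp]
  congr 1
  ext
  change (1 : Λ) * (a * b) = (1 * a) * b
  rw [mul_assoc]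

/-- The bimodule isomorphism is `a ↦ ⟨r_a, r_(-)⟩`, with `r_a` the right multiplication by `a` on
the regular module in degree zero: the two naturality conditions make it linear on the two sides. -/
lemma NaturalHomDuality.isSymmetricAlgebra (d : NaturalHomDuality.{w} k Λ) :
    IsSymmetricAlgebra k Λ := by
  let P : (perfect Λ).FullSubcategory := ⟨_, perfect_singleFunctor_self Λ⟩
  let X : (fromSmallMod Λ).FullSubcategory := ⟨_, fromSmallMod_singleFunctor_self Λ⟩
  have := d.isPerfPair P X
  let ρ := regularEndEquiv k Λ
  refine ⟨ρ ≪≫ₗ (d.pairing P X).toPerfPair ≪≫ₗ ρ.dualMap, fun a x y => ?_, fun x b y => ?_⟩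
  · change d.pairing P X (ρ (a * x)) (ρ y) = d.pairing P X (ρ x) (ρ (y * a))
    rw [regularEndEquiv_mul, regularEndEquiv_mul]
    exact d.natural_left (P := P) (P' := P) (X := X) _ _ _
  · change d.pairing P X (ρ (x * b)) (ρ y) = d.pairing P X (ρ x) (ρ (b * y))
    rw [regularEndEquiv_mul, regularEndEquiv_mul]
    exact d.natural_right (P := P) (X := X) (X' := X) _ _ _

end Perfect

end SymmetricDuality

theorem mainTheorem3 (k : Type u) (Λ : Type v) [Field k] [Ring Λ] [Algebra k Λ]
    [FiniteDimensional k Λ] [HasDerivedCategory.{w} (ModuleCat.{v} Λ)] :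
    SymmetricDuality.IsSymmetricAlgebra k Λ ↔
      Nonempty (SymmetricDuality.NaturalHomDuality.{w} k Λ) :=
  ⟨fun h => let ⟨t⟩ := h.nonempty_symmetrizingForm; ⟨t.naturalHomDuality⟩,
    fun ⟨d⟩ => d.isSymmetricAlgebra⟩
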